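/- **Geometry.** Let $d\in\mathbb N$, let $\Omega\subset\mathbb R^d$ be a bounded open set, $Y=[0,1]^d$, and let $Y_s\subset Y$ be closed. For $\varepsilon>0$ put $$\Omega^\varepsilon=\Omega\setminus\bigcup\{\varepsilon(Y_s+k):\ k\in\mathbb Z^d,\ \varepsilon(Y+k)\subset\overline\Omega\}.$$ Let $V^\varepsilon$ be the space of all $u\in H^1(\Omega^\varepsilon)$ that vanish on the exterior boundary, i.e. that are $H^1(\Omega^\varepsilon)$-limits of restrictions to $\Omega^\varepsilon$ of functions in $C_c^\infty(\Omega)$. Let $S\subset(0,1]$ be the set of scales considered (for example $S=(0,1)$), and let $C_p\in(0,\infty]$ be any upper bound for the best constant in the Poincaré inequality $\|u\|_{L^2(\Omega^\varepsilon)}^2\le C_p\|\nabla u\|_{L^2(\Omega^\varepsilon)}^2$, $u\in V^\varepsilon$, $\varepsilon\in S$ (with $\infty^{-1}=0$). **Data.** Let $\mathbf A:\mathbb R^d\to\mathbb R^{d\times d}$ be bounded, $Y$-periodic, symmetric, globally Lipschitz, with $\underline\gamma|\xi|^2\le \mathbf A(y)\xi\cdot\xi\le\overline\gamma|\xi|^2$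 for all $y,\xi\in\mathbb R^d$, where $\underline\gamma,\overline\gamma>0$. Let $f\in L^2(\Omega)$ and $\alpha\ge0$. Let $\mathcal R:\mathbb R\to\mathbb R$ be degenerate at $x_0\in\mathbb R$ with constants $\delta_0,\delta_1>0$, i.e. $\mathcal R$ is a.e. differentiable and $0\le\mathcal R'\le\delta_1$ a.e.; if, for some $s$, the one-sided limits of $\mathcal R'$ at $s$ (along points of differentiability) exist and their product is $0$, then $s=x_0$; and $\mathcal R'\ge\delta_0$ a.e. outside some ball around $x_0$. Let $\eta>0$, $\sigma>0$, let $(\gamma_k)_{k\ge1}$ be positive and non-increasing, and let $\mathcal R_{\gamma_k}:\mathbb R\to\mathbb R$ be regularizations of $\mathcal R$: each $\mathcal R_{\gamma_k}$ is Lipschitz with $\gamma_k\delta_0\le\mathcal R_{\gamma_k}'\le\delta_1$ a.e., and $|\mathcal R-\mathcal R_{\gamma_k}|\le c\,\gamma_k^{\sigma}$ on $\mathbb R$ with $c$ independent of $k$. Let $\omega\in(0,1)$ and suppose that for some constant $c'$ $$\gamma_{k-1}^{\sigma}/\gamma_k\le c'\omega^k\qquad\text{for all }k\ge2 .$$ **Problems.**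 For $\varepsilon\in S$ let $a(u,\varphi)=\int_{\Omega^\varepsilon}\mathbf A(x/\varepsilon)\nabla u\cdot\nabla\varphi\,dx$, $M=\eta+\varepsilon^\alpha\delta_1$, and write $\langle\cdot,\cdot\rangle$ for the inner product of $L^2(\Omega^\varepsilon)$. A weak solution $u_\varepsilon\in V^\varepsilon$ satisfies $$a(u_\varepsilon,\varphi)+\varepsilon^\alpha\langle\mathcal R(u_\varepsilon),\varphi\rangle=\langle f,\varphi\rangle\qquad\text{for all }\varphi\in V^\varepsilon,$$ and the linearized iterates are $u_\varepsilon^0=0$ and, for $k\ge1$, $u_\varepsilon^k\in V^\varepsilon$ with $$a(u_\varepsilon^k,\varphi)+M\langle u_\varepsilon^k,\varphi\rangle=\langle f,\varphi\rangle+M\langle u_\varepsilon^{k-1},\varphi\rangle-\varepsilon^\alpha\langle\mathcal R_{\gamma_k}(u_\varepsilon^{k-1}),\varphi\rangle\qquad\text{for all }\varphi\in V^\varepsilon .$$ **Claim.** There is a constant $C>0$, independent of $\varepsilon$ and $k$, such that for every $\varepsilon\in S$ with $$\overline\omega:=\omega+\sqrt{\frac{M}{\underline\gamma C_p^{-1}+M}}<1$$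 there are a unique weak solution $u_\varepsilon$ and a unique sequence of iterates $(u_\varepsilon^k)_{k\ge0}$, and for all $k\ge1$ $$\sqrt{\frac{\underline\gamma}{\eta+\delta_1+\underline\gamma C_p^{-1}}}\;\|\nabla(u_\varepsilon-u_\varepsilon^k)\|_{L^2(\Omega^\varepsilon)}+\|u_\varepsilon-u_\varepsilon^k\|_{L^2(\Omega^\varepsilon)}\le\frac{C\,\overline\omega^{\,k}}{1-\overline\omega}.$$ -/

import Mathlib

open MeasureTheory Set Filter Topology
open scoped ENNReal NNReal

noncomputable section

namespace Perforated

/-- Euclidean space of dimension `d`. -/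
abbrev Space (d : ℕ) := EuclideanSpace ℝ (Fin d)

/-! ### The perforated domain -/

/-- The closed unit cell `Y = [0,1]^d`. -/
def unitCell (d : ℕ) : Set (Space d) := {y | ∀ i, y i ∈ Icc (0 : ℝ) 1}

/-- The lattice vector of `ℝ^d` with integer coordinates `k`. -/
def latticeVec {d : ℕ} (k : Fin d → ℤ) : Space d := WithLp.toLp 2 (fun i => (k i : ℝ))

/-- The scaled and translated copy `ε (X + k)` of a subset `X` of the unit cell. -/
def scaledCopy {d : ℕ} (ε : ℝ) (k : Fin d → ℤ) (X : Set (Space d)) : Set (Space d) :=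
  (fun y => ε • (y + latticeVec k)) '' X

/-- The union of the holes `ε (Ys + k)`, over all cells `ε (Y + k)` contained in `closure Ω`. -/
def holes {d : ℕ} (Ω Ys : Set (Space d)) (ε : ℝ) : Set (Space d) :=
  ⋃ k ∈ {k : Fin d → ℤ | scaledCopy ε k (unitCell d) ⊆ closure Ω}, scaledCopy ε k Ys

/-- The perforated domain `Ω^ε`. -/
def perforatedDomain {d : ℕ} (Ω Ys : Set (Space d)) (ε : ℝ) : Set (Space d) :=
  Ω \ holes Ω Ys ε

/-! ### Sobolev spaces -/

/-- Pairs consisting of a scalar function and of a vector field (the candidate gradient), both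
square integrable on `U`. -/
abbrev L2Pair {d : ℕ} (U : Set (Space d)) :=
  Lp ℝ 2 (volume.restrict U) × Lp (Space d) 2 (volume.restrict U)

/-- The Sobolev space `H^1(U)`: an element is recorded as the pair `(u, ∇u)`, where `∇u` is the
weak gradient of `u` on `U`. -/
def sobolevH1 {d : ℕ} (U : Set (Space d)) : Set (L2Pair U) :=
  {p | ∀ φ : Space d → ℝ, ContDiff ℝ (⊤ : ℕ∞) φ → HasCompactSupport φ → tsupport φ ⊆ U →
    ∀ i : Fin d,
      ∫ x in U, p.1 x * fderiv ℝ φ x (EuclideanSpace.single i 1) = -∫ x in U, p.2 x i * φ x}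

/-- The space of all `u ∈ H^1(U)`, `U ⊆ Ω`, with `u = 0` on the exterior boundary `∂Ω ∩ ∂U`:
those that are `H^1(U)`-limits of (restrictions to `U` of) smooth functions that vanish near `∂Ω`.
Nothing is prescribed on the part of `∂U` that lies inside `Ω`. -/
def sobolevV {d : ℕ} (Ω U : Set (Space d)) : Set (L2Pair U) :=
  {p | p ∈ sobolevH1 U ∧
    p ∈ closure {q : L2Pair U | ∃ φ : Space d → ℝ,
      ContDiff ℝ (⊤ : ℕ∞) φ ∧ HasCompactSupport φ ∧ tsupport φ ⊆ Ω ∧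
      q.1 =ᵐ[volume.restrict U] φ ∧ q.2 =ᵐ[volume.restrict U] gradient φ}}

/-- The space `V^ε` on the perforated domain `Ω^ε`. -/
abbrev spaceV {d : ℕ} (Ω Ys : Set (Space d)) (ε : ℝ) : Set (L2Pair (perforatedDomain Ω Ys ε)) :=
  sobolevV Ω (perforatedDomain Ω Ys ε)

/-- The best constant `c ∈ [0,∞]` in the Poincaré inequality `‖u‖² ≤ c ‖∇u‖²` for all `u ∈ V^ε` and
all scales `ε ∈ S`: the supremum of the quotients `‖u‖² / ‖∇u‖²`. -/
def bestPoincareConst {d : ℕ} (Ω Ys : Set (Space d)) (S : Set ℝ) : ℝ≥0∞ :=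
  ⨆ ε ∈ S, ⨆ p ∈ spaceV Ω Ys ε, ‖p.1‖ₑ ^ 2 / ‖p.2‖ₑ ^ 2

/-! ### The data of the problem -/

/-- The assumptions on the diffusion matrix: bounded, `Y`-periodic, symmetric, globally Lipschitz,
and uniformly elliptic with constants `γl` and `γu`. -/
structure IsDiffusion {d : ℕ} (A : Space d → Matrix (Fin d) (Fin d) ℝ) (γl γu : ℝ) : Prop where
  lower_pos : 0 < γl
  upper_pos : 0 < γu
  bounded : ∃ K : ℝ, ∀ y i j, |A y i j| ≤ K
  periodic : ∀ y (k : Fin d → ℤ), A (y + latticeVec k) = A y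
  symmetric : ∀ y, (A y).IsSymm
  lipschitz : ∃ L : ℝ≥0, ∀ i j, LipschitzWith L (fun y => A y i j)
  lower : ∀ y (ξ : Space d), γl * ‖ξ‖ ^ 2 ≤ ∑ i, ∑ j, A y i j * ξ i * ξ j
  upper : ∀ y (ξ : Space d), ∑ i, ∑ j, A y i j * ξ i * ξ j ≤ γu * ‖ξ‖ ^ 2

/-- `F` is degenerate at (at most) the point `x₀`, with constants `δ₀` and `δ₁`. One-sided limits
of `F'` are taken along the points at which `F` is differentiable. -/
structure IsDegenerateAt (F : ℝ → ℝ) (x₀ δ₀ δ₁ : ℝ) : Prop where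
  lower_pos : 0 < δ₀
  upper_pos : 0 < δ₁
  deriv_bounds : ∀ᵐ x : ℝ, DifferentiableAt ℝ F x ∧ 0 ≤ deriv F x ∧ deriv F x ≤ δ₁
  eq_of_limits : ∀ s a b : ℝ,
    Tendsto (deriv F) (𝓝[Ioi s ∩ {x | DifferentiableAt ℝ F x}] s) (𝓝 a) →
    Tendsto (deriv F) (𝓝[Iio s ∩ {x | DifferentiableAt ℝ F x}] s) (𝓝 b) →
    a * b = 0 → s = x₀
  lower_outside : ∃ r : ℝ, 0 < r ∧ ∀ᵐ x : ℝ, x ∉ Metric.ball x₀ r → δ₀ ≤ deriv F x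

/-- `Fγ` is a regularization of `F` with parameter `γ > 0`: `0 < γ δ₀ ≤ Fγ' ≤ δ₁` and
`|F - Fγ| ≤ c γ^σ`. The bounds on `Fγ'` are asked almost everywhere, for a Lipschitz `Fγ`; every
`Fγ` that satisfies them at all points is Lipschitz. -/
structure IsRegularization (F Fγ : ℝ → ℝ) (γ δ₀ δ₁ σ c : ℝ) : Prop where
  param_pos : 0 < γ
  lipschitz : ∃ K : ℝ≥0, LipschitzWith K Fγ
  deriv_bounds : ∀ᵐ x : ℝ, γ * δ₀ ≤ deriv Fγ x ∧ deriv Fγ x ≤ δ₁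
  close : ∀ x : ℝ, |F x - Fγ x| ≤ c * γ ^ σ

/-! ### The microscopic problem and its linearization -/

/-- The bilinear form `a(u, φ) = ∫_U A(x/ε) ∇u · ∇φ dx`. -/
def diffusionForm {d : ℕ} (A : Space d → Matrix (Fin d) (Fin d) ℝ) (ε : ℝ) (U : Set (Space d))
    (p q : L2Pair U) : ℝ :=
  ∫ x in U, ∑ i, ∑ j, A (ε⁻¹ • x) i j * p.2 x j * q.2 x i

/-- Weak solutions of the microscopic problem `-∇·(A(x/ε)∇u) + ε^α R(u) = f` in `Ω^ε`, with no flux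
across the boundary of the holes and `u = 0` on the exterior boundary. -/
def IsWeakSolution {d : ℕ} (Ω Ys : Set (Space d)) (A : Space d → Matrix (Fin d) (Fin d) ℝ)
    (R : ℝ → ℝ) (f : Space d → ℝ) (α ε : ℝ) (u : L2Pair (perforatedDomain Ω Ys ε)) : Prop :=
  u ∈ spaceV Ω Ys ε ∧ ∀ φ ∈ spaceV Ω Ys ε,
    diffusionForm A ε (perforatedDomain Ω Ys ε) u φ
        + ε ^ α * ∫ x in perforatedDomain Ω Ys ε, R (u.1 x) * φ.1 x
      = ∫ x in perforatedDomain Ω Ys ε, f x * φ.1 x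

/-- The linearized iteration with stabilization constant `M` and regularized reactions `Rreg k`,
started at `u⁰ = 0`. -/
def IsLinearization {d : ℕ} (Ω Ys : Set (Space d)) (A : Space d → Matrix (Fin d) (Fin d) ℝ)
    (Rreg : ℕ → ℝ → ℝ) (f : Space d → ℝ) (α ε M : ℝ)
    (u : ℕ → L2Pair (perforatedDomain Ω Ys ε)) : Prop :=
  u 0 = 0 ∧ ∀ k : ℕ, 1 ≤ k → u k ∈ spaceV Ω Ys ε ∧ ∀ φ ∈ spaceV Ω Ys ε,
    diffusionForm A ε (perforatedDomain Ω Ys ε) (u k) φ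
        + M * ∫ x in perforatedDomain Ω Ys ε, (u k).1 x * φ.1 x
      = (∫ x in perforatedDomain Ω Ys ε, f x * φ.1 x)
        + M * (∫ x in perforatedDomain Ω Ys ε, (u (k - 1)).1 x * φ.1 x)
        - ε ^ α * ∫ x in perforatedDomain Ω Ys ε, Rreg k ((u (k - 1)).1 x) * φ.1 x

/-- The stabilization constant `M = η + ε^α δ₁`. -/
def stabConst (η δ₁ α ε : ℝ) : ℝ := η + ε ^ α * δ₁

/-- The contraction rate `ω + √(M / (γl Cp⁻¹ + M))`; here `∞⁻¹ = 0`. -/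
def contractionRate (ω γl : ℝ) (Cp : ℝ≥0∞) (M : ℝ) : ℝ :=
  ω + √(M / (γl * (Cp⁻¹).toReal + M))

end Perforated

end

noncomputable section

open scoped RealInnerProductSpace

namespace Perforated

/-! ### The abstract linear and semilinear problems -/

/-! Adding `M ⟨u, φ⟩` to both sides turns the weak problem into `a(u, φ) + M ⟨u, φ⟩ = ⟨F u, φ⟩` with
`F w = f + M w - ε^α R(w)`; the iterates solve the same equation with `Fk k` evaluated at the
previous iterate. The slopes of `R` and of its regularizations lie in `[0, δ₁]` and `ε^α δ₁ ≤ M`, so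
`F` and every `Fk k` are `M`-Lipschitz on `L²`.

Write `θ = γl Cp⁻¹`. Testing with the solution and using Poincaré, the resolvent has norm at most `1
/ (θ + M)` on `L²` (`norm_fst_le`). Composed with `F` it contracts with factor `M / (θ + M) < 1`,
which gives the weak solution; Lax–Milgram alone gives the iterates.

The error `e k` satisfies `(θ + M) ‖e (k+1)‖ ≤ M ‖e k‖ + β ω^(k+1)`, where `β ω^k` bounds the
regularization error. Hence `‖e k‖ ≤ D (ω + q)^k` for any `q ≥ M / (θ + M)`, in particular for the
square root in the claim (`norm_fst_error_le`). The energy inequality carries this rate over to the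
gradients (`norm_snd_error_le`). All constants are uniform in `ε` because `η ≤ M ≤ η + δ₁` and the
measure of the perforated domain is at most that of `Ω`. -/

theorem norm_rhs_sub_le {H : Type*} [NormedAddCommGroup H] {F : H → H} {Fk : ℕ → H → H}
    {M β ω : ℝ} (hFk : ∀ k, 1 ≤ k → ∀ x y, ‖Fk k x - Fk k y‖ ≤ M * ‖x - y‖)
    (hclose : ∀ k, 1 ≤ k → ∀ x, ‖F x - Fk k x‖ ≤ β * ω ^ k) (k : ℕ) (x y : H) :
    ‖F x - Fk (k + 1) y‖ ≤ M * ‖x - y‖ + β * ω ^ (k + 1) := by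
  have h1 := hFk (k + 1) (by omega) x y
  have h2 := hclose (k + 1) (by omega) x
  have h3 := norm_sub_le_norm_sub_add_norm_sub (F x) (Fk (k + 1) x) (Fk (k + 1) y)
  linarith

section Abstract

variable {H G : Type*} [NormedAddCommGroup H] [InnerProductSpace ℝ H]
  [NormedAddCommGroup G] [InnerProductSpace ℝ G]

/-- `v ∈ V` solves `a(∇v, ∇φ) + M ⟨v, φ⟩ = ⟨h, φ⟩` for all `φ ∈ V`, where an element of `V` is a
pair made of a function and of its gradient. -/
def SolvesResolvent (V : Submodule ℝ (H × G)) (a : G →L[ℝ] G →L[ℝ] ℝ) (M : ℝ) (h : H)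
    (v : H × G) : Prop :=
  v ∈ V ∧ ∀ φ ∈ V, a v.2 φ.2 + M * ⟪v.1, φ.1⟫ = ⟪h, φ.1⟫

namespace SolvesResolvent

variable {V : Submodule ℝ (H × G)} {a : G →L[ℝ] G →L[ℝ] ℝ} {M γ θ : ℝ}

theorem sub {h h' : H} {v v' : H × G} (hv : SolvesResolvent V a M h v)
    (hv' : SolvesResolvent V a M h' v') : SolvesResolvent V a M (h - h') (v - v') := by
  refine ⟨V.sub_mem hv.1 hv'.1, fun φ hφ => ?_⟩
  have h1 := hv.2 φ hφ
  have h2 := hv'.2 φ hφ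
  simp only [Prod.fst_sub, Prod.snd_sub, map_sub, sub_apply,
    inner_sub_left]
  linarith

theorem energy_le (ha : ∀ g, γ * ‖g‖ ^ 2 ≤ a g g) {h : H} {v : H × G}
    (hv : SolvesResolvent V a M h v) : γ * ‖v.2‖ ^ 2 + M * ‖v.1‖ ^ 2 ≤ ‖h‖ * ‖v.1‖ := by
  have h1 := hv.2 v hv.1
  have h2 := real_inner_le_norm h v.1
  have h3 := ha v.2
  rw [real_inner_self_eq_norm_sq] at h1
  linarith

/-- Poincaré replaces the gradient term of the energy inequality by `θ ‖v.1‖²`; then one factor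
`‖v.1‖` cancels. -/
theorem norm_fst_le (ha : ∀ g, γ * ‖g‖ ^ 2 ≤ a g g)
    (hP : ∀ v ∈ V, θ * ‖v.1‖ ^ 2 ≤ γ * ‖v.2‖ ^ 2) {h : H} {v : H × G}
    (hv : SolvesResolvent V a M h v) : (θ + M) * ‖v.1‖ ≤ ‖h‖ := by
  rcases (norm_nonneg v.1).eq_or_lt with h0 | h0
  · rw [← h0, mul_zero]
    exact norm_nonneg h
  · refine le_of_mul_le_mul_right ?_ h0
    have h1 := hv.energy_le ha
    have h2 := hP v hv.1
    nlinarith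

theorem eq (hγ : 0 < γ) (hM : 0 < M) (ha : ∀ g, γ * ‖g‖ ^ 2 ≤ a g g) {h : H} {v v' : H × G}
    (hv : SolvesResolvent V a M h v) (hv' : SolvesResolvent V a M h v') : v = v' := by
  have h1 := (hv.sub hv').energy_le ha
  rw [sub_self, norm_zero, zero_mul] at h1
  have h2 : 0 ≤ γ * ‖(v - v').2‖ ^ 2 := by positivity
  have h3 : 0 ≤ M * ‖(v - v').1‖ ^ 2 := by positivity
  have h4 : γ * ‖(v - v').2‖ ^ 2 = 0 := by linarith
  have h5 : M * ‖(v - v').1‖ ^ 2 = 0 := by linarith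
  have h6 : (v - v').2 = 0 := by simpa [hγ.ne'] using h4
  have h7 : (v - v').1 = 0 := by simpa [hM.ne'] using h5
  exact sub_eq_zero.1 (Prod.ext h7 h6)

variable [CompleteSpace H] [CompleteSpace G]

/-- Lax–Milgram; since `M > 0`, coercivity needs no Poincaré inequality. -/
theorem exists_solution (hV : IsClosed (V : Set (H × G))) (hγ : 0 < γ) (hM : 0 < M)
    (ha : ∀ g, γ * ‖g‖ ^ 2 ≤ a g g) (h : H) : ∃ v, SolvesResolvent V a M h v := by
  -- The product `H × G` carries the sup norm; `WithLp 2` makes it a Hilbert space with the same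
  -- topology.
  let W : Submodule ℝ (WithLp 2 (H × G)) := V.comap (WithLp.linearEquiv 2 ℝ (H × G)).toLinearMap
  have hW : IsClosed (W : Set (WithLp 2 (H × G))) :=
    hV.preimage (WithLp.prod_continuous_ofLp 2 H G)
  have : CompleteSpace W := hW.completeSpace_coe
  let F : W →L[ℝ] H := (WithLp.fstL 2 ℝ H G).comp W.subtypeL
  let S : W →L[ℝ] G := (WithLp.sndL 2 ℝ H G).comp W.subtypeL
  let I : H →L[ℝ] H →L[ℝ] ℝ :=
    IsBoundedBilinearMap.toContinuousLinearMap (isBoundedBilinearMap_inner (𝕜 := ℝ) (E := H))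
  let B : W →L[ℝ] W →L[ℝ] ℝ := a.bilinearComp S S + M • I.bilinearComp F F
  have hB : ∀ v w : W, B v w = a (S v) (S w) + M * ⟪F v, F w⟫ := fun v w => rfl
  have hn : ∀ v : W, ‖v‖ ^ 2 = ‖F v‖ ^ 2 + ‖S v‖ ^ 2 := fun v =>
    WithLp.prod_norm_sq_eq_of_L2 (v : WithLp 2 (H × G))
  have hc : IsCoercive B := by
    refine ⟨min γ M, lt_min hγ hM, fun v => ?_⟩
    rw [hB, real_inner_self_eq_norm_sq, mul_assoc, ← pow_two, hn]
    have h1 := ha (S v)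
    have h2 := mul_le_mul_of_nonneg_right (min_le_left γ M) (sq_nonneg ‖S v‖)
    have h3 := mul_le_mul_of_nonneg_right (min_le_right γ M) (sq_nonneg ‖F v‖)
    linarith
  let ℓ : StrongDual ℝ W := (I h).comp F
  obtain ⟨v, hv⟩ := hc.continuousLinearEquivOfBilin.surjective
    ((InnerProductSpace.toDual ℝ W).symm ℓ)
  refine ⟨(v : WithLp 2 (H × G)).ofLp, v.2, fun φ hφ => ?_⟩
  have h1 := hc.continuousLinearEquivOfBilin_apply v ⟨WithLp.toLp 2 φ, hφ⟩
  rw [hv, InnerProductSpace.toDual_symm_apply] at h1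
  exact (h1.trans (hB _ _)).symm

/-- A Lipschitz right hand side whose Lipschitz constant is that of the stabilization: the solution
operator is a contraction by the Poincaré inequality. -/
theorem existsUnique_semilinear (hV : IsClosed (V : Set (H × G))) (hγ : 0 < γ) (hM : 0 < M)
    (hθ : 0 < θ) (ha : ∀ g, γ * ‖g‖ ^ 2 ≤ a g g)
    (hP : ∀ v ∈ V, θ * ‖v.1‖ ^ 2 ≤ γ * ‖v.2‖ ^ 2) {F : H → H}
    (hF : ∀ x y, ‖F x - F y‖ ≤ M * ‖x - y‖) : ∃! v, SolvesResolvent V a M (F v.1) v := by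
  choose T hT using fun h => exists_solution (a := a) hV hγ hM ha h
  have hpos : 0 < θ + M := by positivity
  have hlip : ∀ x y, ‖(T (F x)).1 - (T (F y)).1‖ ≤ M / (θ + M) * ‖x - y‖ := fun x y => by
    have h1 := ((hT (F x)).sub (hT (F y))).norm_fst_le ha hP
    have h2 := h1.trans (hF x y)
    rw [div_mul_eq_mul_div, le_div_iff₀ hpos, mul_comm]
    exact h2
  have hρ0 : 0 ≤ M / (θ + M) := by positivity
  have hcontr : ContractingWith (M / (θ + M)).toNNReal (fun x => (T (F x)).1) := by
    refine ⟨?_, LipschitzWith.of_dist_le_mul fun x y => ?_⟩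
    · rw [Real.toNNReal_lt_one, div_lt_one hpos]
      linarith
    · rw [Real.coe_toNNReal _ hρ0, dist_eq_norm, dist_eq_norm]
      exact hlip x y
  -- The fixed point is sought in `H` only; the gradient is recovered by applying `T` once more.
  let x := hcontr.fixedPoint
  have hx : (T (F x)).1 = x := hcontr.fixedPoint_isFixedPt
  refine ⟨T (F x), ?_, fun w hw => ?_⟩
  · simp only [hx]
    exact hT (F x)
  · have h1 : w = T (F w.1) := hw.eq hγ hM ha (hT _)
    have h2 : w.1 = x := hcontr.fixedPoint_unique (congrArg Prod.fst h1).symm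
    rw [h1, h2]

theorem existsUnique_iterates (hV : IsClosed (V : Set (H × G))) (hγ : 0 < γ) (hM : 0 < M)
    (ha : ∀ g, γ * ‖g‖ ^ 2 ≤ a g g) (F : ℕ → H → H) :
    ∃! u : ℕ → H × G, u 0 = 0 ∧
      ∀ k, 1 ≤ k → SolvesResolvent V a M (F k (u (k - 1)).1) (u k) := by
  choose T hT using fun h => exists_solution (a := a) hV hγ hM ha h
  refine ⟨fun n => Nat.rec 0 (fun k v => T (F (k + 1) v.1)) n, ⟨rfl, fun k hk => ?_⟩,
    fun w hw => ?_⟩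
  · obtain ⟨k, rfl⟩ := Nat.exists_eq_add_of_le' hk
    exact hT _
  · funext n
    induction n with
    | zero => exact hw.1
    | succ k ih =>
      have h1 := hw.2 (k + 1) (by omega)
      rw [Nat.add_sub_cancel, ih] at h1
      exact h1.eq hγ hM ha (hT _)

end SolvesResolvent

/-! ### A priori bound and error estimates for the abstract iteration -/

section Error

variable {V : Submodule ℝ (H × G)} {a : G →L[ℝ] G →L[ℝ] ℝ} {M γ θ β ω q : ℝ}

/-- The Lipschitz part `M ‖u.1‖` of the right hand side cancels the stabilization on the left,
leaving only `θ`. -/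
theorem norm_fst_le_of_semilinear (ha : ∀ g, γ * ‖g‖ ^ 2 ≤ a g g)
    (hP : ∀ v ∈ V, θ * ‖v.1‖ ^ 2 ≤ γ * ‖v.2‖ ^ 2) {F : H → H}
    (hF : ∀ x y, ‖F x - F y‖ ≤ M * ‖x - y‖) {u : H × G}
    (hu : SolvesResolvent V a M (F u.1) u) : θ * ‖u.1‖ ≤ ‖F 0‖ := by
  have h1 := hu.norm_fst_le ha hP
  have h2 := hF u.1 0
  have h3 := norm_le_norm_add_norm_sub' (F u.1) (F 0)
  rw [sub_zero] at h2
  linarith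

variable {F : H → H} {Fk : ℕ → H → H} {u : H × G} {uk : ℕ → H × G}

/-- Induction on `k`: the previous error contributes `q D (ω + q)^k` and the regularization at most
`ω D (ω + q)^k`. `D` has to dominate the initial error `‖u.1‖` (as `uk 0 = 0`) and `β / M`. -/
theorem norm_fst_error_le (hM : 0 < M) (hθ : 0 ≤ θ) (hω : 0 < ω) (hq : 0 ≤ q)
    (hMq : M ≤ q * (θ + M)) (ha : ∀ g, γ * ‖g‖ ^ 2 ≤ a g g)
    (hP : ∀ v ∈ V, θ * ‖v.1‖ ^ 2 ≤ γ * ‖v.2‖ ^ 2)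
    (hFk : ∀ k, 1 ≤ k → ∀ x y, ‖Fk k x - Fk k y‖ ≤ M * ‖x - y‖)
    (hclose : ∀ k, 1 ≤ k → ∀ x, ‖F x - Fk k x‖ ≤ β * ω ^ k)
    (hu : SolvesResolvent V a M (F u.1) u) (h0 : uk 0 = 0)
    (huk : ∀ k, 1 ≤ k → SolvesResolvent V a M (Fk k (uk (k - 1)).1) (uk k)) {D : ℝ}
    (huD : ‖u.1‖ ≤ D) (hβD : β ≤ M * D) (k : ℕ) :
    ‖(u - uk k).1‖ ≤ D * (ω + q) ^ k := by
  induction k with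
  | zero => simpa [h0] using huD
  | succ k ih =>
    have hs := huk (k + 1) (by omega)
    rw [Nat.add_sub_cancel] at hs
    have h1 := (hu.sub hs).norm_fst_le ha hP
    have h2 := norm_rhs_sub_le hFk hclose k u.1 (uk k).1
    have hD : 0 ≤ D := (norm_nonneg _).trans huD
    have h3 : ω ^ k ≤ (ω + q) ^ k := pow_le_pow_left₀ hω.le (by linarith) k
    have h4 : β * ω ^ (k + 1) ≤ (θ + M) * (D * (ω * (ω + q) ^ k)) := by
      calc β * ω ^ (k + 1) ≤ ((θ + M) * D) * (ω * (ω + q) ^ k) := by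
            rw [pow_succ']
            have : M * D ≤ (θ + M) * D := by gcongr; linarith
            gcongr
            linarith
        _ = _ := by ring
    have h5 : M * ‖u.1 - (uk k).1‖ ≤ (θ + M) * (q * (D * (ω + q) ^ k)) := by
      calc M * ‖u.1 - (uk k).1‖ ≤ (q * (θ + M)) * (D * (ω + q) ^ k) := by
            gcongr
            exact ih
        _ = _ := by ring
    refine le_of_mul_le_mul_left ?_ (show 0 < θ + M by positivity)
    calc (θ + M) * ‖(u - uk (k + 1)).1‖ ≤ _ := h1.trans h2
      _ ≤ _ := add_le_add h5 h4
      _ = _ := by ring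

/-- In the energy inequality for the error, both factors on the right are of order `(ω + q)^k`, so
the square root keeps the rate. -/
theorem norm_snd_error_le (hM : 0 < M) (hγ : 0 < γ) (hω : 0 < ω) (hq : 0 ≤ q)
    (ha : ∀ g, γ * ‖g‖ ^ 2 ≤ a g g)
    (hFk : ∀ k, 1 ≤ k → ∀ x y, ‖Fk k x - Fk k y‖ ≤ M * ‖x - y‖)
    (hclose : ∀ k, 1 ≤ k → ∀ x, ‖F x - Fk k x‖ ≤ β * ω ^ k)
    (hu : SolvesResolvent V a M (F u.1) u)
    (huk : ∀ k, 1 ≤ k → SolvesResolvent V a M (Fk k (uk (k - 1)).1) (uk k)) {D : ℝ}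
    (hD : 0 ≤ D) (hω1 : ω ≤ 1) (hβD : β ≤ M * D)
    (herr : ∀ k, ‖(u - uk k).1‖ ≤ D * (ω + q) ^ k) (k : ℕ) (hk : 1 ≤ k) :
    ‖(u - uk k).2‖ ≤ √(2 * M / (ω * γ)) * (D * (ω + q) ^ k) := by
  obtain ⟨k, rfl⟩ := Nat.exists_eq_add_of_le' hk
  have hs := huk (k + 1) (by omega)
  rw [Nat.add_sub_cancel] at hs
  have h1 := (hu.sub hs).energy_le ha
  have h2 := norm_rhs_sub_le hFk hclose k u.1 (uk k).1
  have h3 : ω ^ (k + 1) ≤ (ω + q) ^ (k + 1) := pow_le_pow_left₀ hω.le (by linarith) _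
  set t := (ω + q) ^ (k + 1) with ht
  have ht0 : 0 ≤ t := by positivity
  -- The right hand side involves the previous iterate, one power behind; the shift costs the factor
  -- `1 / ω`.
  have h4 : (ω + q) ^ k ≤ t / ω := by
    rw [le_div_iff₀ hω, ht, pow_succ]
    gcongr
    linarith
  have h5 : ‖u.1 - (uk k).1‖ ≤ D * (t / ω) := (herr k).trans (by gcongr)
  have h6 : β * ω ^ (k + 1) ≤ M * D * (t / ω) := by
    have h7 : t ≤ t / ω := le_div_self ht0 hω hω1
    calc β * ω ^ (k + 1) ≤ M * D * ω ^ (k + 1) := by gcongr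
      _ ≤ _ := by gcongr; exact h3.trans h7
  have h8 : ‖F u.1 - Fk (k + 1) (uk k).1‖ ≤ 2 * M / ω * (D * t) :=
    calc _ ≤ _ := h2
      _ ≤ M * (D * (t / ω)) + M * D * (t / ω) := by gcongr
      _ = _ := by ring
  have h9 : γ * ‖(u - uk (k + 1)).2‖ ^ 2 ≤ 2 * M / ω * (D * t) * (D * t) := by
    have : 0 ≤ M * ‖(u - uk (k + 1)).1‖ ^ 2 := by positivity
    calc γ * ‖(u - uk (k + 1)).2‖ ^ 2
        ≤ ‖F u.1 - Fk (k + 1) (uk k).1‖ * ‖(u - uk (k + 1)).1‖ := by linarith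
      _ ≤ _ := by gcongr; exact herr (k + 1)
  have h10 : 0 ≤ D * t := by positivity
  rw [← Real.sqrt_sq h10, ← Real.sqrt_mul (by positivity)]
  refine Real.le_sqrt_of_sq_le ?_
  have h11 : 2 * M / (ω * γ) * (D * t) ^ 2 = 2 * M / ω * (D * t) * (D * t) / γ := by
    field_simp
  rw [h11, le_div_iff₀ hγ, mul_comm]
  exact h9

end Error

end Abstract

/-! ### Real functions with increments bounded between those of `0` and of `δ • id` -/

/-- `g` is non-decreasing, with slopes at most `δ`. -/
def SlopeBound (g : ℝ → ℝ) (δ : ℝ) : Prop :=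
  ∀ s t, s ≤ t → 0 ≤ g t - g s ∧ g t - g s ≤ δ * (t - s)

/-- Lipschitz functions are absolutely continuous, so increments are integrals of the derivative. -/
theorem slopeBound_of_deriv {g : ℝ → ℝ} {K : ℝ≥0} (hg : LipschitzWith K g) {δ : ℝ}
    (h : ∀ᵐ x : ℝ, 0 ≤ deriv g x ∧ deriv g x ≤ δ) : SlopeBound g δ := by
  intro s t hst
  have hac : AbsolutelyContinuousOnInterval g s t :=
    (hg.lipschitzOnWith (s := uIcc s t)).absolutelyContinuousOnInterval
  rw [← hac.integral_deriv_eq_sub]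
  constructor
  · refine intervalIntegral.integral_nonneg_of_ae_restrict hst ?_
    filter_upwards [ae_restrict_of_ae h] with x hx using hx.1
  · have h1 := intervalIntegral.integral_mono_ae hst hac.intervalIntegrable_deriv
      (intervalIntegrable_const (c := δ) (μ := volume)) (h.mono fun x hx => hx.2)
    rwa [intervalIntegral.integral_const, smul_eq_mul, mul_comm] at h1

/-- This is for `R` itself: bounds on its derivative almost everywhere do not control its increments
(Cantor function), but `R` is a limit of its Lipschitz regularizations. -/
theorem SlopeBound.of_tendsto {g : ℝ → ℝ} {gk : ℕ → ℝ → ℝ} {δ : ℝ}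
    (h : ∀ᶠ k in atTop, SlopeBound (gk k) δ)
    (hlim : ∀ x, Tendsto (fun k => gk k x) atTop (𝓝 (g x))) : SlopeBound g δ := by
  intro s t hst
  have h1 := (hlim t).sub (hlim s)
  exact ⟨ge_of_tendsto h1 (h.mono fun k hk => (hk s t hst).1),
    le_of_tendsto h1 (h.mono fun k hk => (hk s t hst).2)⟩

theorem SlopeBound.lipschitz {g : ℝ → ℝ} {δ : ℝ} (hg : SlopeBound g δ) (hδ : 0 ≤ δ) :
    LipschitzWith δ.toNNReal g := by
  have key : ∀ s t, s ≤ t → |g t - g s| ≤ δ * |t - s| := fun s t hst => by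
    rw [abs_of_nonneg (hg s t hst).1, abs_of_nonneg (sub_nonneg.2 hst)]
    exact (hg s t hst).2
  refine LipschitzWith.of_dist_le_mul fun s t => ?_
  rw [Real.coe_toNNReal _ hδ, Real.dist_eq, Real.dist_eq]
  rcases le_total t s with h | h
  · exact key t s h
  · rw [abs_sub_comm, abs_sub_comm s t]
    exact key s t h

/-- Subtracting `e • g` from the stabilization leaves the Lipschitz constant of the latter. -/
theorem SlopeBound.lipschitz_stab {g : ℝ → ℝ} {δ e M : ℝ} (hg : SlopeBound g δ) (he : 0 ≤ e)
    (hM : e * δ ≤ M) (hM0 : 0 ≤ M) : LipschitzWith M.toNNReal (fun s => M * s - e * g s) := by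
  have key : ∀ s t, s ≤ t → |(M * t - e * g t) - (M * s - e * g s)| ≤ M * |t - s| := by
    intro s t hst
    obtain ⟨h1, h2⟩ := hg s t hst
    have h3 : 0 ≤ t - s := by linarith
    have h4 : e * (g t - g s) ≤ e * (δ * (t - s)) := by gcongr
    have h5 : e * δ * (t - s) ≤ M * (t - s) := by gcongr
    have h6 : 0 ≤ e * (g t - g s) := by positivity
    rw [abs_of_nonneg h3, abs_le]
    constructor <;> nlinarith
  refine LipschitzWith.of_dist_le_mul fun s t => ?_
  rw [Real.coe_toNNReal _ hM0, Real.dist_eq, Real.dist_eq]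
  rcases le_total t s with h | h
  · exact key t s h
  · rw [abs_sub_comm, abs_sub_comm s t]
    exact key s t h

/-! ### Superposition operators on `L²` -/

section Superposition

variable {X : Type*} [MeasurableSpace X] {μ : Measure X} [IsFiniteMeasure μ]

theorem memLp_lipschitz_comp {K : ℝ≥0} {g : ℝ → ℝ} (hg : LipschitzWith K g) (w : Lp ℝ 2 μ) :
    MemLp (fun x => g (w x)) 2 μ := by
  -- Normalized to vanish at `0`; the constant `g 0` is in `L²` because the measure is finite.
  have h1 : LipschitzWith K (fun s => g s - g 0) := by
    refine LipschitzWith.of_dist_le_mul fun s t => ?_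
    simpa using hg.dist_le_mul s t
  have h2 := (h1.comp_memLp (sub_self _) (Lp.memLp w)).add (memLp_const (g 0))
  refine h2.congr_norm ?_ (ae_of_all _ fun x => ?_)
  · exact hg.continuous.comp_aestronglyMeasurable (Lp.aestronglyMeasurable w)
  · simp

/-- The superposition operator `w ↦ g ∘ w` on `L²`, for a Lipschitz function `g`. -/
def superposition (μ : Measure X) [IsFiniteMeasure μ] {K : ℝ≥0} {g : ℝ → ℝ}
    (hg : LipschitzWith K g) (w : Lp ℝ 2 μ) : Lp ℝ 2 μ :=
  (memLp_lipschitz_comp hg w).toLp _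

theorem coeFn_superposition {K : ℝ≥0} {g : ℝ → ℝ} (hg : LipschitzWith K g) (w : Lp ℝ 2 μ) :
    superposition μ hg w =ᵐ[μ] fun x => g (w x) :=
  MemLp.coeFn_toLp _

theorem norm_superposition_sub_le {K : ℝ≥0} {g : ℝ → ℝ} (hg : LipschitzWith K g)
    (v w : Lp ℝ 2 μ) : ‖superposition μ hg v - superposition μ hg w‖ ≤ K * ‖v - w‖ := by
  apply Lp.norm_le_mul_norm_of_ae_le_mul
  filter_upwards [coeFn_superposition hg v, coeFn_superposition hg w,
    Lp.coeFn_sub (superposition μ hg v) (superposition μ hg w), Lp.coeFn_sub v w]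
    with x h1 h2 h3 h4
  rw [h3, h4, Pi.sub_apply, Pi.sub_apply, h1, h2, ← dist_eq_norm, ← dist_eq_norm]
  exact hg.dist_le_mul _ _

theorem norm_superposition_sub_superposition_le {K K' : ℝ≥0} {g g' : ℝ → ℝ}
    (hg : LipschitzWith K g) (hg' : LipschitzWith K' g') {B : ℝ} (hB : ∀ s, |g s - g' s| ≤ B)
    (w : Lp ℝ 2 μ) : ‖superposition μ hg w - superposition μ hg' w‖ ≤
      (measureUnivNNReal μ : ℝ) ^ (2 : ℝ≥0∞).toReal⁻¹ * B := by
  refine Lp.norm_le_of_ae_bound ((abs_nonneg _).trans (hB 0)) ?_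
  filter_upwards [coeFn_superposition hg w, coeFn_superposition hg' w,
    Lp.coeFn_sub (superposition μ hg w) (superposition μ hg' w)] with x h1 h2 h3
  rw [h3, Pi.sub_apply, h1, h2]
  exact hB _

theorem norm_superposition_zero_le {K : ℝ≥0} {g : ℝ → ℝ} (hg : LipschitzWith K g) :
    ‖superposition μ hg 0‖ ≤ (measureUnivNNReal μ : ℝ) ^ (2 : ℝ≥0∞).toReal⁻¹ * |g 0| := by
  refine Lp.norm_le_of_ae_bound (abs_nonneg _) ?_
  filter_upwards [coeFn_superposition hg 0, Lp.coeFn_zero ℝ 2 μ] with x h1 h2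
  rw [h1, h2, Pi.zero_apply, Real.norm_eq_abs]

end Superposition

/-! ### Bilinear forms on `L²` -/

section Forms

variable {X : Type*} [MeasurableSpace X] {μ : Measure X}

/-- The pairing of `L²` with itself. -/
def pairing (μ : Measure X) : Lp ℝ 2 μ →L[ℝ] Lp ℝ 2 μ →L[ℝ] ℝ :=
  (ContinuousLinearMap.mul ℝ ℝ).lpPairing μ 2 2

theorem pairing_apply (v w : Lp ℝ 2 μ) : pairing μ v w = ∫ x, v x * w x ∂μ :=
  (ContinuousLinearMap.mul ℝ ℝ).lpPairing_eq_integral v w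

theorem inner_eq_integral_mul (v w : Lp ℝ 2 μ) : ⟪v, w⟫ = ∫ x, v x * w x ∂μ := by
  rw [L2.inner_def]
  exact integral_congr_ae (ae_of_all _ fun x => by simp [mul_comm])

/-- Multiplication by a bounded measurable function, on `L²`. -/
def mulBounded {b : X → ℝ} (hb : MemLp b ∞ μ) : Lp ℝ 2 μ →L[ℝ] Lp ℝ 2 μ :=
  (ContinuousLinearMap.mul ℝ ℝ).holderL μ ∞ 2 2 (hb.toLp b)

theorem coeFn_mulBounded {b : X → ℝ} (hb : MemLp b ∞ μ) (w : Lp ℝ 2 μ) :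
    mulBounded hb w =ᵐ[μ] fun x => b x * w x := by
  have h := (ContinuousLinearMap.mul ℝ ℝ).coeFn_holder (r := 2) (hb.toLp b) w
  filter_upwards [h, hb.coeFn_toLp] with x h1 h2
  rw [← h2]
  exact h1

variable {d : ℕ}

/-- The `i`-th component of a square integrable vector field. -/
def component (μ : Measure X) (i : Fin d) : Lp (Space d) 2 μ →L[ℝ] Lp ℝ 2 μ :=
  (EuclideanSpace.proj i : Space d →L[ℝ] ℝ).compLpL 2 μ

theorem coeFn_component (i : Fin d) (w : Lp (Space d) 2 μ) :
    component μ i w =ᵐ[μ] fun x => w x i :=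
  (EuclideanSpace.proj i : Space d →L[ℝ] ℝ).coeFn_compLpL w

/-- The form `(p, q) ↦ ∫ b p · q` with a bounded matrix valued coefficient `b`. -/
def matrixForm {b : Fin d → Fin d → X → ℝ} (hb : ∀ i j, MemLp (b i j) ∞ μ) :
    Lp (Space d) 2 μ →L[ℝ] Lp (Space d) 2 μ →L[ℝ] ℝ :=
  ∑ i, ∑ j, (pairing μ).bilinearComp ((mulBounded (hb i j)).comp (component μ j)) (component μ i)

theorem matrixForm_apply {b : Fin d → Fin d → X → ℝ} (hb : ∀ i j, MemLp (b i j) ∞ μ)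
    (p q : Lp (Space d) 2 μ) : Integrable (fun x => ∑ i, ∑ j, b i j x * p x j * q x i) μ ∧
      matrixForm hb p q = ∫ x, ∑ i, ∑ j, b i j x * p x j * q x i ∂μ := by
  have hae : ∀ i j, (fun x => mulBounded (hb i j) (component μ j p) x * component μ i q x)
      =ᵐ[μ] fun x => b i j x * p x j * q x i := fun i j => by
    filter_upwards [coeFn_mulBounded (hb i j) (component μ j p), coeFn_component i q,
      coeFn_component j p] with x h1 h2 h3
    rw [h1, h2, h3]
  have hint : ∀ i j, Integrable (fun x => b i j x * p x j * q x i) μ := fun i j =>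
    ((Lp.memLp (mulBounded (hb i j) (component μ j p))).integrable_mul
      (Lp.memLp (component μ i q))).congr (hae i j)
  refine ⟨integrable_finsetSum _ fun i _ => integrable_finsetSum _ fun j _ => hint i j, ?_⟩
  rw [integral_finsetSum _ fun i _ => integrable_finsetSum _ fun j _ => hint i j]
  simp only [matrixForm, sum_apply]
  refine Finset.sum_congr rfl fun i _ => ?_
  rw [integral_finsetSum _ fun j _ => hint i j]
  refine Finset.sum_congr rfl fun j _ => ?_
  rw [← integral_congr_ae (hae i j), ← pairing_apply]
  rfl

theorem le_matrixForm {b : Fin d → Fin d → X → ℝ} (hb : ∀ i j, MemLp (b i j) ∞ μ) {γ : ℝ}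
    (hγ : ∀ x, ∀ ξ : Space d, γ * ‖ξ‖ ^ 2 ≤ ∑ i, ∑ j, b i j x * ξ i * ξ j)
    (p : Lp (Space d) 2 μ) : γ * ‖p‖ ^ 2 ≤ matrixForm hb p p := by
  obtain ⟨h1, h2⟩ := matrixForm_apply hb p p
  rw [h2, ← real_inner_self_eq_norm_sq, L2.inner_def, ← integral_const_mul]
  refine integral_mono ((L2.integrable_inner p p).const_mul γ) h1 fun x => ?_
  have h3 := hγ x (p x)
  simp only [real_inner_self_eq_norm_sq]
  refine h3.trans (le_of_eq ?_)
  refine Finset.sum_congr rfl fun i _ => Finset.sum_congr rfl fun j _ => by ring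

end Forms

/-! ### The space `V` is a closed subspace -/

section Sobolev

variable {d : ℕ}

theorem memLp_of_continuous_compactSupport {φ : Space d → ℝ} (hφ : Continuous φ)
    (hc : HasCompactSupport φ) (U : Set (Space d)) : MemLp φ 2 (volume.restrict U) :=
  (hφ.memLp_of_hasCompactSupport hc).mono_measure Measure.restrict_le_self

/-- The linear functional that expresses that `p.2` is the weak gradient of `p.1`, tested with the
pair made of a function and of its `i`-th derivative. -/
def weakGradientDefect (U : Set (Space d)) (i : Fin d) (g h : Lp ℝ 2 (volume.restrict U)) :
    L2Pair U →L[ℝ] ℝ :=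
  ((pairing _).flip g).comp (ContinuousLinearMap.fst ℝ _ _) +
    (((pairing _).flip h).comp (component _ i)).comp (ContinuousLinearMap.snd ℝ _ _)

theorem weakGradientDefect_apply (U : Set (Space d)) (i : Fin d) {g h : Space d → ℝ}
    (hg : MemLp g 2 (volume.restrict U)) (hh : MemLp h 2 (volume.restrict U)) (p : L2Pair U) :
    weakGradientDefect U i (hg.toLp g) (hh.toLp h) p =
      (∫ x in U, p.1 x * g x) + ∫ x in U, p.2 x i * h x := by
  have h1 : weakGradientDefect U i (hg.toLp g) (hh.toLp h) p =
      pairing _ p.1 (hg.toLp g) + pairing _ (component _ i p.2) (hh.toLp h) := rfl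
  rw [h1, pairing_apply, pairing_apply]
  congr 1
  · refine integral_congr_ae ?_
    filter_upwards [hg.coeFn_toLp] with x hx
    rw [hx]
  · refine integral_congr_ae ?_
    filter_upwards [hh.coeFn_toLp, coeFn_component i p.2] with x hx hx'
    rw [hx, hx']

/-- Each test function and index imposes the vanishing of one continuous linear functional, so the
space is an intersection of closed kernels. -/
theorem exists_submodule_sobolevH1 (U : Set (Space d)) :
    ∃ W : Submodule ℝ (L2Pair U), IsClosed (W : Set (L2Pair U)) ∧ (W : Set _) = sobolevH1 U := by
  have key : ∀ (φ : Space d → ℝ) (i : Fin d), ContDiff ℝ (⊤ : ℕ∞) φ → HasCompactSupport φ →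
      ∃ ℓ : L2Pair U →L[ℝ] ℝ, ∀ p, ℓ p = 0 ↔
        ∫ x in U, p.1 x * fderiv ℝ φ x (EuclideanSpace.single i 1) = -∫ x in U, p.2 x i * φ x := by
    intro φ i hφ hc
    have h1 : MemLp (fun x => fderiv ℝ φ x (EuclideanSpace.single i 1)) 2 (volume.restrict U) :=
      memLp_of_continuous_compactSupport ((hφ.continuous_fderiv (by simp)).clm_apply
        continuous_const) (hc.fderiv_apply ℝ _) U
    have h2 := memLp_of_continuous_compactSupport hφ.continuous hc U
    refine ⟨weakGradientDefect U i (h1.toLp _) (h2.toLp _), fun p => ?_⟩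
    rw [weakGradientDefect_apply, add_eq_zero_iff_eq_neg]
  choose ℓ hℓ using key
  refine ⟨⨅ (φ : Space d → ℝ) (i : Fin d) (h : ContDiff ℝ (⊤ : ℕ∞) φ) (hc : HasCompactSupport φ)
    (_ : tsupport φ ⊆ U), (ℓ φ i h hc).ker, ?_, ?_⟩
  · simp only [Submodule.coe_iInf]
    exact isClosed_iInter fun φ => isClosed_iInter fun i => isClosed_iInter fun h =>
      isClosed_iInter fun hc => isClosed_iInter fun _ => (ℓ φ i h hc).isClosed_ker
  · ext p
    simp only [Submodule.coe_iInf, mem_iInter, SetLike.mem_coe, LinearMap.mem_ker, sobolevH1,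
      mem_ofPred_eq]
    exact ⟨fun h φ h1 h2 h3 i => (hℓ φ i h1 h2 p).1 (h φ i h1 h2 h3),
      fun h φ i h1 h2 h3 => (hℓ φ i h1 h2 p).2 (h φ h1 h2 h3 i)⟩

theorem gradient_add {φ ψ : Space d → ℝ} (hφ : Differentiable ℝ φ) (hψ : Differentiable ℝ ψ) :
    gradient (φ + ψ) = gradient φ + gradient ψ := by
  funext x
  simp only [gradient, Pi.add_apply, ← map_add]
  rw [fderiv_add (hφ x) (hψ x)]

theorem gradient_const_smul {φ : Space d → ℝ} (hφ : Differentiable ℝ φ) (r : ℝ) :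
    gradient (r • φ) = r • gradient φ := by
  funext x
  simp only [gradient, Pi.smul_apply]
  rw [fderiv_const_smul (hφ x)]
  simp

/-- The pairs `(φ, ∇φ)` for smooth functions `φ` with compact support in `Ω`. -/
def testPairs (Ω U : Set (Space d)) : Submodule ℝ (L2Pair U) where
  carrier := {q : L2Pair U | ∃ φ : Space d → ℝ,
      ContDiff ℝ (⊤ : ℕ∞) φ ∧ HasCompactSupport φ ∧ tsupport φ ⊆ Ω ∧
      q.1 =ᵐ[volume.restrict U] φ ∧ q.2 =ᵐ[volume.restrict U] gradient φ}
  zero_mem' := by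
    refine ⟨0, contDiff_const, HasCompactSupport.zero, by simp [tsupport], Lp.coeFn_zero _ _ _, ?_⟩
    have h : gradient (0 : Space d → ℝ) = 0 := by
      funext x
      simp [gradient]
    rw [h]
    exact Lp.coeFn_zero _ _ _
  add_mem' := by
    rintro p q ⟨φ, h1, h2, h3, h4, h5⟩ ⟨ψ, k1, k2, k3, k4, k5⟩
    refine ⟨φ + ψ, h1.add k1, h2.add k2, (tsupport_add φ ψ).trans (union_subset h3 k3), ?_, ?_⟩
    · exact (Lp.coeFn_add p.1 q.1).trans (h4.add k4)
    · rw [gradient_add (h1.differentiable (by simp)) (k1.differentiable (by simp))]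
      exact (Lp.coeFn_add p.2 q.2).trans (h5.add k5)
  smul_mem' := by
    rintro r p ⟨φ, h1, h2, h3, h4, h5⟩
    refine ⟨r • φ, h1.const_smul r, h2.smul_left (f := fun _ => r),
      (closure_mono (Function.support_const_smul_subset r φ)).trans h3, ?_, ?_⟩
    · exact (Lp.coeFn_smul r p.1).trans (h4.const_smul r)
    · rw [gradient_const_smul (h1.differentiable (by simp))]
      exact (Lp.coeFn_smul r p.2).trans (h5.const_smul r)

theorem exists_submodule_sobolevV (Ω U : Set (Space d)) :
    ∃ V : Submodule ℝ (L2Pair U), IsClosed (V : Set (L2Pair U)) ∧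
      ∀ p, p ∈ V ↔ p ∈ sobolevV Ω U := by
  obtain ⟨W, hW, hWU⟩ := exists_submodule_sobolevH1 U
  refine ⟨W ⊓ (testPairs Ω U).topologicalClosure, ?_, fun p => ?_⟩
  · exact hW.inter (Submodule.isClosed_topologicalClosure _)
  · rw [Submodule.mem_inf, ← SetLike.mem_coe, hWU]
    -- The carrier of `testPairs` is literally the set whose closure enters `sobolevV`.
    rfl

end Sobolev

variable {d : ℕ}

/-! ### The regularizations -/

theorem exists_geometric_bound {γ : ℕ → ℝ} {σ c ω : ℝ} (hγ : ∀ k, 1 ≤ k → 0 < γ k)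
    (hγ_anti : ∀ k, 1 ≤ k → γ (k + 1) ≤ γ k) (hω : 0 < ω) (hω1 : ω < 1)
    (hγω : ∃ c' : ℝ, ∀ k, 2 ≤ k → γ (k - 1) ^ σ / γ k ≤ c' * ω ^ k) :
    ∃ B : ℝ, 0 ≤ B ∧ ∀ k, 1 ≤ k → c * γ k ^ σ ≤ B * ω ^ k := by
  obtain ⟨c', hc'⟩ := hγω
  have hγ1 : ∀ k, 1 ≤ k → γ k ≤ γ 1 := fun k hk => by
    induction k, hk using Nat.le_induction with
    | base => exact le_rfl
    | succ k hk ih => exact (hγ_anti k hk).trans ih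
  have h0 := hγ 1 le_rfl
  refine ⟨|c| * (|c'| * γ 1), by positivity, fun k hk => ?_⟩
  -- At index `k + 1` the hypothesis controls `γ k ^ σ` by `ω ^ (k + 1) * γ (k + 1)`, and
  -- monotonicity gives `γ (k + 1) ≤ γ 1`.
  have h1 := hc' (k + 1) (by omega)
  have h2 := hγ (k + 1) (by omega)
  rw [Nat.add_sub_cancel, div_le_iff₀ h2] at h1
  have h3 : 0 ≤ γ k ^ σ := Real.rpow_nonneg (hγ k hk).le σ
  have h4 : γ k ^ σ ≤ |c'| * γ 1 * ω ^ k := by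
    calc γ k ^ σ ≤ c' * ω ^ (k + 1) * γ (k + 1) := h1
      _ ≤ |c'| * ω ^ k * γ 1 := by
        gcongr ?_ * ?_ * ?_
        · exact le_abs_self c'
        · exact pow_le_pow_of_le_one hω.le hω1.le (by omega)
        · exact hγ1 _ (by omega)
      _ = _ := by ring
  calc c * γ k ^ σ ≤ |c| * γ k ^ σ := by gcongr; exact le_abs_self c
    _ ≤ |c| * (|c'| * γ 1 * ω ^ k) := by gcongr
    _ = _ := by ring

theorem IsRegularization.slopeBound {F Fγ : ℝ → ℝ} {γ δ₀ δ₁ σ c : ℝ}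
    (h : IsRegularization F Fγ γ δ₀ δ₁ σ c) (hδ₀ : 0 < δ₀) : SlopeBound Fγ δ₁ := by
  obtain ⟨K, hK⟩ := h.lipschitz
  refine slopeBound_of_deriv hK (h.deriv_bounds.mono fun x hx => ⟨?_, hx.2⟩)
  exact (mul_pos h.param_pos hδ₀).le.trans hx.1

/-! ### The Poincaré inequality -/

theorem poincare_of_bestPoincareConst_le {Ω Ys : Set (Space d)} {S : Set ℝ} {Cp : ℝ≥0∞}
    (hCp_top : Cp ≠ ∞) (hCp : bestPoincareConst Ω Ys S ≤ Cp) {ε : ℝ} (hε : ε ∈ S)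
    {p : L2Pair (perforatedDomain Ω Ys ε)} (hp : p ∈ spaceV Ω Ys ε) :
    (Cp⁻¹).toReal * ‖p.1‖ ^ 2 ≤ ‖p.2‖ ^ 2 := by
  have h1 : ‖p.1‖ₑ ^ 2 / ‖p.2‖ₑ ^ 2 ≤ Cp := by
    refine le_trans ?_ hCp
    refine le_iSup₂_of_le ε hε ?_
    exact le_iSup₂_of_le (f := fun (q : L2Pair (perforatedDomain Ω Ys ε))
      (_ : q ∈ spaceV Ω Ys ε) => ‖q.1‖ₑ ^ 2 / ‖q.2‖ₑ ^ 2) p hp le_rfl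
  have h2 : ‖p.1‖ₑ ^ 2 ≤ Cp * ‖p.2‖ₑ ^ 2 :=
    -- If the gradient vanishes, the quotient is `0` or `∞`; finiteness of `Cp` excludes `∞` and so
    -- forces the function to vanish.
    (ENNReal.div_le_iff_le_mul (Or.inr hCp_top) (Or.inl (by finiteness))).1 h1
  have h3 : ‖p.1‖ ^ 2 ≤ Cp.toReal * ‖p.2‖ ^ 2 := by
    have := ENNReal.toReal_mono (by finiteness) h2
    simpa [ENNReal.toReal_mul, ENNReal.toReal_pow] using this
  rw [ENNReal.toReal_inv]
  rcases (ENNReal.toReal_nonneg (a := Cp)).eq_or_lt with h0 | h0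
  -- For `Cp = 0` the real inverse is `0` by convention and the claim is trivial.
  · rw [← h0, inv_zero, zero_mul]
    positivity
  · rwa [inv_mul_le_iff₀ h0]

/-! ### The right hand side of the linearized problem -/

section RightHandSide

variable {X : Type*} [MeasurableSpace X] {μ : Measure X} [IsFiniteMeasure μ]

/-- The operator `w ↦ f + g ∘ w` on `L²`. -/
def affineSuperposition {f : X → ℝ} (hf : MemLp f 2 μ) {K : ℝ≥0} {g : ℝ → ℝ}
    (hg : LipschitzWith K g) (w : Lp ℝ 2 μ) : Lp ℝ 2 μ :=
  hf.toLp f + superposition μ hg w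

theorem inner_affineSuperposition {f : X → ℝ} (hf : MemLp f 2 μ) {K K' : ℝ≥0} {g : ℝ → ℝ}
    (hg : LipschitzWith K g) {M e : ℝ} (hs : LipschitzWith K' fun s => M * s - e * g s)
    (w φ : Lp ℝ 2 μ) : ⟪affineSuperposition hf hs w, φ⟫ =
      (∫ x, f x * φ x ∂μ) + M * (∫ x, w x * φ x ∂μ) - e * ∫ x, g (w x) * φ x ∂μ := by
  have h1 : Integrable (fun x => f x * φ x) μ := hf.integrable_mul (Lp.memLp φ)
  have h2 : Integrable (fun x => w x * φ x) μ := (Lp.memLp w).integrable_mul (Lp.memLp φ)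
  have h3 : Integrable (fun x => g (w x) * φ x) μ :=
    (memLp_lipschitz_comp hg w).integrable_mul (Lp.memLp φ)
  have h4 : Integrable (fun x => f x * φ x + M * (w x * φ x)) μ := h1.add (h2.const_mul M)
  rw [inner_eq_integral_mul, ← integral_const_mul, ← integral_const_mul,
    ← integral_add h1 (h2.const_mul M), ← integral_sub h4 (h3.const_mul e)]
  refine integral_congr_ae ?_
  filter_upwards [Lp.coeFn_add (hf.toLp f) (superposition μ hs w), hf.coeFn_toLp,
    coeFn_superposition hs w] with x k1 k2 k3
  rw [affineSuperposition, k1, Pi.add_apply, k2, k3]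
  ring

theorem norm_affineSuperposition_sub_le {f : X → ℝ} (hf : MemLp f 2 μ) {M : ℝ} (hM : 0 ≤ M)
    {g : ℝ → ℝ} (hg : LipschitzWith M.toNNReal g) (v w : Lp ℝ 2 μ) :
    ‖affineSuperposition hf hg v - affineSuperposition hf hg w‖ ≤ M * ‖v - w‖ := by
  have h := norm_superposition_sub_le hg v w
  rw [Real.coe_toNNReal _ hM] at h
  rwa [affineSuperposition, affineSuperposition, add_sub_add_left_eq_sub]

end RightHandSide

/-! ### Reduction of the perforated problem to the abstract one -/

theorem measureUnivNNReal_restrict_mono {X : Type*} [MeasurableSpace X] {μ : Measure X}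
    {U Ω : Set X} (hU : U ⊆ Ω) (hΩ : μ Ω ≠ ∞) :
    measureUnivNNReal (μ.restrict U) ≤ measureUnivNNReal (μ.restrict Ω) := by
  simp only [measureUnivNNReal, Measure.restrict_apply_univ]
  exact ENNReal.toNNReal_mono hΩ (measure_mono hU)

theorem IsDiffusion.memLp_coeff {A : Space d → Matrix (Fin d) (Fin d) ℝ} {γl γu : ℝ}
    (hA : IsDiffusion A γl γu) (ε : ℝ) (U : Set (Space d)) (i j : Fin d) :
    MemLp (fun x => A (ε⁻¹ • x) i j) ∞ (volume.restrict U) := by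
  obtain ⟨K, hK⟩ := hA.bounded
  obtain ⟨L, hL⟩ := hA.lipschitz
  have h : Continuous fun x => A (ε⁻¹ • x) i j :=
    (hL i j).continuous.comp (continuous_const_smul ε⁻¹)
  exact memLp_top_of_bound h.aestronglyMeasurable K (ae_of_all _ fun x => hK _ i j)

theorem isWeakSolution_iff {Ω Ys : Set (Space d)} {A : Space d → Matrix (Fin d) (Fin d) ℝ}
    {R : ℝ → ℝ} {f : Space d → ℝ} {α ε M : ℝ}
    [IsFiniteMeasure (volume.restrict (perforatedDomain Ω Ys ε))]
    (hf : MemLp f 2 (volume.restrict (perforatedDomain Ω Ys ε)))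
    {K K' : ℝ≥0} (hR : LipschitzWith K R) (hs : LipschitzWith K' fun s => M * s - ε ^ α * R s)
    (hA : ∀ i j, MemLp (fun x => A (ε⁻¹ • x) i j) ∞ (volume.restrict (perforatedDomain Ω Ys ε)))
    {V : Submodule ℝ (L2Pair (perforatedDomain Ω Ys ε))} (hV : ∀ p, p ∈ V ↔ p ∈ spaceV Ω Ys ε)
    (u : L2Pair (perforatedDomain Ω Ys ε)) :
    IsWeakSolution Ω Ys A R f α ε u ↔
      SolvesResolvent V (matrixForm hA) M (affineSuperposition hf hs u.1) u := by
  refine and_congr (hV u).symm (forall_congr' fun φ => imp_congr (hV φ).symm ?_)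
  rw [inner_affineSuperposition hf hR hs, (matrixForm_apply hA u.2 φ.2).2, inner_eq_integral_mul,
    diffusionForm]
  constructor <;> intro h <;> linarith

theorem isLinearization_iff {Ω Ys : Set (Space d)} {A : Space d → Matrix (Fin d) (Fin d) ℝ}
    {Rreg : ℕ → ℝ → ℝ} {f : Space d → ℝ} {α ε M : ℝ}
    {H : ℕ → Lp ℝ 2 (volume.restrict (perforatedDomain Ω Ys ε)) →
      Lp ℝ 2 (volume.restrict (perforatedDomain Ω Ys ε))}
    (hH : ∀ k, 1 ≤ k → ∀ w φ : Lp ℝ 2 (volume.restrict (perforatedDomain Ω Ys ε)), ⟪H k w, φ⟫ =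
      (∫ x in perforatedDomain Ω Ys ε, f x * φ x)
        + M * (∫ x in perforatedDomain Ω Ys ε, w x * φ x)
        - ε ^ α * ∫ x in perforatedDomain Ω Ys ε, Rreg k (w x) * φ x)
    (hA : ∀ i j, MemLp (fun x => A (ε⁻¹ • x) i j) ∞ (volume.restrict (perforatedDomain Ω Ys ε)))
    {V : Submodule ℝ (L2Pair (perforatedDomain Ω Ys ε))} (hV : ∀ p, p ∈ V ↔ p ∈ spaceV Ω Ys ε)
    (u : ℕ → L2Pair (perforatedDomain Ω Ys ε)) :
    IsLinearization Ω Ys A Rreg f α ε M u ↔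
      u 0 = 0 ∧ ∀ k, 1 ≤ k →
        SolvesResolvent V (matrixForm hA) M (H k (u (k - 1)).1) (u k) := by
  refine and_congr Iff.rfl (forall_congr' fun k => forall_congr' fun hk =>
    and_congr (hV _).symm (forall_congr' fun φ => imp_congr (hV φ).symm ?_))
  rw [hH k hk, (matrixForm_apply hA (u k).2 φ.2).2, inner_eq_integral_mul, diffusionForm]

end Perforated

end

/-! ### The main theorem, with constants uniform in the scale -/

theorem mainTheorem2 {d : ℕ} (Ω Ys : Set (Perforated.Space d))
    (hΩ_open : IsOpen Ω) (hΩ_bdd : Bornology.IsBounded Ω)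
    (hYs_closed : IsClosed Ys) (hYs_sub : Ys ⊆ Perforated.unitCell d)
    -- the scales under consideration, for example all of `(0,1)`
    (S : Set ℝ) (hS : S ⊆ Set.Ioc 0 1)
    -- the data
    (A : Perforated.Space d → Matrix (Fin d) (Fin d) ℝ) (γl γu : ℝ)
    (hA : Perforated.IsDiffusion A γl γu)
    (R : ℝ → ℝ) (x₀ δ₀ δ₁ : ℝ) (hR : Perforated.IsDegenerateAt R x₀ δ₀ δ₁)
    (f : Perforated.Space d → ℝ) (hf : MemLp f 2 (volume.restrict Ω))
    (α : ℝ) (hα : 0 ≤ α)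
    -- the regularization
    (γ : ℕ → ℝ) (hγ_anti : ∀ k, 1 ≤ k → γ (k + 1) ≤ γ k)
    (σ : ℝ) (hσ : 0 < σ) (Rreg : ℕ → ℝ → ℝ) (c : ℝ)
    (hRreg : ∀ k, 1 ≤ k → Perforated.IsRegularization R (Rreg k) (γ k) δ₀ δ₁ σ c)
    (ω : ℝ) (hω : ω ∈ Set.Ioo (0 : ℝ) 1)
    (hγω : ∃ c' : ℝ, ∀ k, 2 ≤ k → γ (k - 1) ^ σ / γ k ≤ c' * ω ^ k)
    (η : ℝ) (hη : 0 < η)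
    -- any upper bound `Cp ∈ (0,∞]` of the best Poincaré constant
    (Cp : ℝ≥0∞) (hCp_pos : 0 < Cp) (hCp : Perforated.bestPoincareConst Ω Ys S ≤ Cp) :
    ∃ C : ℝ, 0 < C ∧ ∀ ε ∈ S, ∀ M ωbar : ℝ,
      M = Perforated.stabConst η δ₁ α ε →
      ωbar = Perforated.contractionRate ω γl Cp M →
      ωbar < 1 →
      (∃! u, Perforated.IsWeakSolution Ω Ys A R f α ε u) ∧
      (∃! u, Perforated.IsLinearization Ω Ys A Rreg f α ε M u) ∧
      ∀ u uk, Perforated.IsWeakSolution Ω Ys A R f α ε u →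
        Perforated.IsLinearization Ω Ys A Rreg f α ε M uk →
        ∀ k : ℕ, 1 ≤ k →
          √(γl / (η + δ₁ + γl * (Cp⁻¹).toReal)) * ‖u.2 - (uk k).2‖ + ‖u.1 - (uk k).1‖
            ≤ C * ωbar ^ k / (1 - ωbar) := by
  have hδ₀ := hR.lower_pos
  have hδ₁ := hR.upper_pos
  have hγl := hA.lower_pos
  obtain ⟨hω0, hω1⟩ := hω
  rcases eq_or_ne Cp ∞ with rfl | hCp_top
  -- Without a Poincaré inequality the rate is `ω + 1 > 1`, so the claim is vacuous.
  · refine ⟨1, one_pos, fun ε hε M ωbar hM hωbar hlt => ?_⟩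
    have hεα : 0 ≤ ε ^ α := Real.rpow_nonneg (hS hε).1.le α
    have hM0 : 0 < M := by
      rw [hM, Perforated.stabConst]
      positivity
    rw [hωbar, Perforated.contractionRate, ENNReal.inv_top, ENNReal.toReal_zero, mul_zero,
      zero_add, div_self hM0.ne', Real.sqrt_one] at hlt
    linarith
  set θ := γl * (Cp⁻¹).toReal with hθ_def
  have hθ : 0 < θ := by
    have : 0 < (Cp⁻¹).toReal :=
      ENNReal.toReal_pos (ENNReal.inv_ne_zero.2 hCp_top) (ENNReal.inv_ne_top.2 hCp_pos.ne')
    positivity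
  obtain ⟨B, hB0, hB⟩ := Perforated.exists_geometric_bound (c := c)
    (fun k hk => (hRreg k hk).param_pos) hγ_anti hω0 hω1 hγω
  have hclose : ∀ k, 1 ≤ k → ∀ x, |R x - Rreg k x| ≤ B * ω ^ k := fun k hk x =>
    ((hRreg k hk).close x).trans (hB k hk)
  have hslope : ∀ k, 1 ≤ k → Perforated.SlopeBound (Rreg k) δ₁ := fun k hk =>
    (hRreg k hk).slopeBound hδ₀
  have hRslope : Perforated.SlopeBound R δ₁ := by
    refine Perforated.SlopeBound.of_tendsto (gk := Rreg) ?_ fun x => ?_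
    · filter_upwards [eventually_ge_atTop 1] with k hk using hslope k hk
    · have h1 : Tendsto (fun k => B * ω ^ k) atTop (𝓝 0) := by
        simpa using (tendsto_pow_atTop_nhds_zero_of_lt_one hω0.le hω1).const_mul B
      refine tendsto_iff_dist_tendsto_zero.2 (squeeze_zero' (Eventually.of_forall fun _ =>
        dist_nonneg) ?_ h1)
      filter_upwards [eventually_ge_atTop 1] with k hk
      rw [dist_comm]
      exact hclose k hk x
  have hΩ_fin : volume Ω ≠ ∞ := hΩ_bdd.measure_lt_top.ne
  let m : ℝ := (measureUnivNNReal (volume.restrict Ω) : ℝ) ^ (2 : ℝ≥0∞).toReal⁻¹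
  have hm : 0 ≤ m := by positivity
  let N : ℝ := (eLpNorm f 2 (volume.restrict Ω)).toReal
  have hN : 0 ≤ N := ENNReal.toReal_nonneg
  -- The first summand bounds `‖u.1‖` through `‖F 0‖ / θ`; the second ensures `m * B ≤ M * D`, since
  -- `η ≤ M`.
  let D : ℝ := (N + m * |R 0|) / θ + m * B / η
  have hD : 0 ≤ D := by positivity
  let C₂ : ℝ := √(2 * (η + δ₁) / (ω * γl))
  let C₁ : ℝ := √(γl / (η + δ₁ + θ))
  refine ⟨C₁ * (C₂ * D) + D + 1, by positivity, fun ε hε M ωbar hM hωbar hlt => ?_⟩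
  obtain ⟨hε0, hε1⟩ := hS hε
  have hεα : 0 ≤ ε ^ α := Real.rpow_nonneg hε0.le α
  have hεα1 : ε ^ α ≤ 1 := Real.rpow_le_one hε0.le hε1 hα
  have hMη : η ≤ M := by
    rw [hM, Perforated.stabConst]
    linarith [mul_nonneg hεα hδ₁.le]
  have hMδ : ε ^ α * δ₁ ≤ M := by
    rw [hM, Perforated.stabConst]
    linarith
  have hM_le : M ≤ η + δ₁ := by
    rw [hM, Perforated.stabConst]
    linarith [mul_le_mul_of_nonneg_right hεα1 hδ₁.le]
  have hM0 : 0 < M := hη.trans_le hMη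
  let q : ℝ := √(M / (θ + M))
  have hq : 0 ≤ q := Real.sqrt_nonneg _
  have hωbar' : ωbar = ω + q := hωbar
  -- The natural factor `M / (θ + M)` is at most `1`, hence at most its square root `q`.
  have hMq : M ≤ q * (θ + M) := by
    rw [← div_le_iff₀ (by positivity)]
    refine Real.le_sqrt_of_sq_le ?_
    have h1 : M / (θ + M) ≤ 1 := (div_le_one (by positivity)).2 (by linarith)
    have h2 : 0 ≤ M / (θ + M) := by positivity
    nlinarith
  have hU : Perforated.perforatedDomain Ω Ys ε ⊆ Ω := sdiff_subset
  have hfin : IsFiniteMeasure (volume.restrict (Perforated.perforatedDomain Ω Ys ε)) :=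
    isFiniteMeasure_restrict.2 (ne_top_of_le_ne_top hΩ_fin (measure_mono hU))
  have hmono := Measure.restrict_mono_set (volume : Measure (Perforated.Space d)) hU
  have hfU := hf.mono_measure hmono
  have hfN : ‖hfU.toLp f‖ ≤ N := by
    rw [Lp.norm_toLp]
    exact ENNReal.toReal_mono hf.2.ne (eLpNorm_mono_measure f hmono)
  have hmU : (measureUnivNNReal (volume.restrict (Perforated.perforatedDomain Ω Ys ε)) : ℝ) ^
      (2 : ℝ≥0∞).toReal⁻¹ ≤ m :=
    Real.rpow_le_rpow (by positivity)
      (NNReal.coe_le_coe.2 (Perforated.measureUnivNNReal_restrict_mono hU hΩ_fin)) (by positivity)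
  obtain ⟨V, hV_closed, hV⟩ := Perforated.exists_submodule_sobolevV Ω
    (Perforated.perforatedDomain Ω Ys ε)
  have hAmem := hA.memLp_coeff ε (Perforated.perforatedDomain Ω Ys ε)
  have hell := Perforated.le_matrixForm hAmem (γ := γl) fun x ξ => hA.lower (ε⁻¹ • x) ξ
  have hP : ∀ v ∈ V, θ * ‖v.1‖ ^ 2 ≤ γl * ‖v.2‖ ^ 2 := fun v hv => by
    rw [hθ_def, mul_assoc]
    exact mul_le_mul_of_nonneg_left
      (Perforated.poincare_of_bestPoincareConst_le hCp_top hCp hε ((hV v).1 hv)) hγl.le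
  have hs := hRslope.lipschitz_stab hεα hMδ hM0.le
  let F := Perforated.affineSuperposition hfU hs
  have hF : ∀ v w, ‖F v - F w‖ ≤ M * ‖v - w‖ :=
    Perforated.norm_affineSuperposition_sub_le hfU hM0.le hs
  have hF0 : ‖F 0‖ ≤ N + m * |R 0| := by
    have h1 := Perforated.norm_superposition_zero_le
      (μ := volume.restrict (Perforated.perforatedDomain Ω Ys ε)) hs
    rw [mul_zero, zero_sub, abs_neg, abs_mul, abs_of_nonneg hεα] at h1
    refine (norm_add_le _ _).trans (add_le_add hfN (h1.trans ?_))
    gcongr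
    exact mul_le_of_le_one_left (abs_nonneg _) hεα1
  have hexFk : ∀ k, ∃ Fk : Lp ℝ 2 (volume.restrict (Perforated.perforatedDomain Ω Ys ε)) →
      Lp ℝ 2 (volume.restrict (Perforated.perforatedDomain Ω Ys ε)), 1 ≤ k →
      (∀ v w, ‖Fk v - Fk w‖ ≤ M * ‖v - w‖) ∧ (∀ w, ‖F w - Fk w‖ ≤ m * B * ω ^ k) ∧
      ∀ w φ : Lp ℝ 2 (volume.restrict (Perforated.perforatedDomain Ω Ys ε)), inner ℝ (Fk w) φ =
        (∫ x in Perforated.perforatedDomain Ω Ys ε, f x * φ x)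
          + M * (∫ x in Perforated.perforatedDomain Ω Ys ε, w x * φ x)
          - ε ^ α * ∫ x in Perforated.perforatedDomain Ω Ys ε, Rreg k (w x) * φ x := fun k => by
    by_cases hk : 1 ≤ k
    · have hsk := (hslope k hk).lipschitz_stab hεα hMδ hM0.le
      refine ⟨Perforated.affineSuperposition hfU hsk, fun _ =>
        ⟨Perforated.norm_affineSuperposition_sub_le hfU hM0.le hsk, fun w => ?_,
          Perforated.inner_affineSuperposition hfU ((hslope k hk).lipschitz hδ₁.le) hsk⟩⟩
      have h1 : ∀ s, |(M * s - ε ^ α * R s) - (M * s - ε ^ α * Rreg k s)| ≤ B * ω ^ k := fun s => by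
        rw [sub_sub_sub_cancel_left, ← mul_sub, abs_mul, abs_of_nonneg hεα, abs_sub_comm]
        exact (mul_le_of_le_one_left (abs_nonneg _) hεα1).trans (hclose k hk s)
      have h2 := Perforated.norm_superposition_sub_superposition_le hs hsk h1 w
      simp only [F, Perforated.affineSuperposition, add_sub_add_left_eq_sub]
      refine h2.trans ?_
      rw [mul_assoc]
      gcongr
    · exact ⟨0, fun h => absurd h hk⟩
  choose Fk hFk using hexFk
  have hFk_lip : ∀ k, 1 ≤ k → ∀ v w, ‖Fk k v - Fk k w‖ ≤ M * ‖v - w‖ := fun k hk => (hFk k hk).1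
  have hFk_close : ∀ k, 1 ≤ k → ∀ w, ‖F w - Fk k w‖ ≤ m * B * ω ^ k := fun k hk => (hFk k hk).2.1
  have hweak := Perforated.isWeakSolution_iff hfU (hRslope.lipschitz hδ₁.le) hs hAmem hV
  have hlin := Perforated.isLinearization_iff (fun k hk => (hFk k hk).2.2) hAmem hV
  simp only [hweak, hlin]
  refine ⟨Perforated.SolvesResolvent.existsUnique_semilinear hV_closed hγl hM0 hθ hell hP hF,
    Perforated.SolvesResolvent.existsUnique_iterates hV_closed hγl hM0 hell Fk,
    fun u uk hu huk k hk => ?_⟩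
  have huD : ‖u.1‖ ≤ D := by
    have h1 := Perforated.norm_fst_le_of_semilinear hell hP hF hu
    have h2 : ‖u.1‖ ≤ (N + m * |R 0|) / θ := by
      rw [le_div_iff₀ hθ, mul_comm]
      exact h1.trans hF0
    exact h2.trans (le_add_of_nonneg_right (by positivity))
  have hβD : m * B ≤ M * D := by
    have h1 : m * B = η * (m * B / η) := by field_simp
    rw [h1]
    gcongr
    exact le_add_of_nonneg_left (by positivity)
  have herr := Perforated.norm_fst_error_le hM0 hθ.le hω0 hq hMq hell hP hFk_lip hFk_close hu
    huk.1 huk.2 huD hβD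
  have hgrad := Perforated.norm_snd_error_le hM0 hγl hω0 hq hell hFk_lip hFk_close hu huk.2 hD
    hω1.le hβD herr k hk
  have h1 := herr k
  rw [← hωbar'] at hgrad h1
  have hωbar0 : 0 ≤ ωbar := by
    rw [hωbar']
    positivity
  have hC₂ : √(2 * M / (ω * γl)) ≤ C₂ := Real.sqrt_le_sqrt (by gcongr)
  calc C₁ * ‖(u - uk k).2‖ + ‖(u - uk k).1‖
      ≤ C₁ * (C₂ * (D * ωbar ^ k)) + D * ωbar ^ k := by
        have h2 : ‖(u - uk k).2‖ ≤ C₂ * (D * ωbar ^ k) := hgrad.trans (by gcongr)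
        exact add_le_add (mul_le_mul_of_nonneg_left h2 (Real.sqrt_nonneg _)) h1
    _ = (C₁ * (C₂ * D) + D) * ωbar ^ k := by ring
    -- The summand `1` only makes the constant positive, as `D` may vanish.
    _ ≤ (C₁ * (C₂ * D) + D + 1) * ωbar ^ k := by
        refine mul_le_mul_of_nonneg_right ?_ (by positivity)
        linarith
    -- Since `0 < 1 - ωbar ≤ 1`, dividing only weakens the bound just obtained.
    _ ≤ _ := le_div_self (by positivity) (by linarith) (by linarith)
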